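/- A $(0,1)$-matrix is simple if it has no repeated columns. A $(0,1)$-matrix $F$ is a configuration in a $(0,1)$-matrix $A$ if some submatrix of $A$ is a row and column permutation of $F$. Let $\mathrm{Avoid}(m,F)$ be the set of simple $m$-rowed $(0,1)$-matrices in which $F$ is not a configuration, let $\mathrm{forb}(m,F)$ be the maximum number of columns of a matrix in $\mathrm{Avoid}(m,F)$, and let $\mathrm{Ext}(m,F)$ be the set of matrices in $\mathrm{Avoid}(m,F)$ with exactly $\mathrm{forb}(m,F)$ columns. Let $F(0,8,1,0)$ be the $2\times 9$ matrix with eight columns equal to $\binom{1}{0}$ and one column equal to $\binom{0}{1}$. **Theorem.** For every integer $m\ge 0$, $$\mathrm{forb}(m,F(0,8,1,0))\le\left\lfloor\tfrac{27}{5}m\right\rfloor+1,$$ with equality whenever $m\equiv 0\pmod 5$. Equality is attained by the following explicit matrices. Let $K_5^s$ be the $5\times\binom5s$ matrix of all columns with exactly $s$ ones. The $5\times 28$ matrix $$E=\left[K_5^0\;K_5^1\;\begin{array}{cccccccccccccccc} 1&1&1&1&0&0&0&0&1&1&1&1&0&0&0&0\\ 1&0&0&0&1&1&0&0&1&1&0&0&1&1&1&0\\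 0&1&0&0&1&0&1&0&1&0&1&0&1&1&0&1\\ 0&0&1&0&0&1&0&1&0&0&1&1&1&0&1&1\\ 0&0&0&1&0&0&1&1&0&1&0&1&0&1&1&1 \end{array}\;K_5^4\;K_5^5\right]$$ belongs to $\mathrm{Ext}(5,F(0,8,1,0))$. More generally, let $B$ be $E$ with its column of $1$'s deleted. For every $t\ge 0$, the $5t\times(27t+1)$ matrix $$\begin{bmatrix} B&\mathbf 1&\cdots&\mathbf 1&\mathbf 1\\ \mathbf 0&B&\cdots&\mathbf 1&\mathbf 1\\ \vdots&\vdots&\ddots&\vdots&\vdots\\ \mathbf 0&\mathbf 0&\cdots&B&\mathbf 1 \end{bmatrix}$$ with $t$ diagonal blocks $B$, all $1$'s above them, all $0$'s below them, and a last column of $1$'s, belongs to $\mathrm{Ext}(5t,F(0,8,1,0))$. -/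

import Mathlib

/-- A (0,1)-matrix (entries in `Fin 2`) is simple if it has no repeated columns. -/
def IsSimple {R C : Type*} (A : Matrix R C (Fin 2)) : Prop :=
  Function.Injective A.transpose

/-- `F` is a configuration in `A` (`F ≺ A`): some submatrix of `A` is a row and column
permutation of `F`, that is, `F` is obtained from `A` by choosing distinct rows in some order and
distinct columns in some order. -/
def IsConfiguration {R' C' R C : Type*} (F : Matrix R' C' (Fin 2)) (A : Matrix R C (Fin 2)) :
    Prop :=
  ∃ (r : R' ↪ R) (c : C' ↪ C), A.submatrix r c = F

/-- `Avoid(m, F)`: the simple `m`-rowed (0,1)-matrices, with any number of columns, in which `F`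
is not a configuration. An element is a pair of its number of columns and the matrix. -/
def Avoid (m : ℕ) {k l : ℕ} (F : Matrix (Fin k) (Fin l) (Fin 2)) :
    Set (Σ n : ℕ, Matrix (Fin m) (Fin n) (Fin 2)) :=
  {A | IsSimple A.2 ∧ ¬ IsConfiguration F A.2}

/-- `forb(m, F)`: the maximum number of columns of a matrix in `Avoid(m, F)`. The maximum exists
as soon as `F` has a column, see `isGreatest_forb`. -/
noncomputable def forb (m : ℕ) {k l : ℕ} (F : Matrix (Fin k) (Fin l) (Fin 2)) : ℕ :=
  sSup (Sigma.fst '' Avoid m F)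

/-- The supremum in the definition of `forb` is a maximum. -/
theorem isGreatest_forb (m : ℕ) {k l : ℕ} (hl : 0 < l) (F : Matrix (Fin k) (Fin l) (Fin 2)) :
    IsGreatest (Sigma.fst '' Avoid m F) (forb m F) := by
  have hne : (Sigma.fst '' Avoid m F).Nonempty := by
    refine ⟨0, ⟨0, fun _ j => j.elim0⟩, ⟨fun j => j.elim0, ?_⟩, rfl⟩
    rintro ⟨_, c, _⟩
    exact (c ⟨0, hl⟩).elim0
  have hbdd : BddAbove (Sigma.fst '' Avoid m F) := by
    refine ⟨2 ^ m, ?_⟩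
    rintro _ ⟨⟨n, A⟩, ⟨hA, _⟩, rfl⟩
    have h := Fintype.card_le_of_injective (fun j : Fin n => (fun i : Fin m => A i j)) hA
    simpa using h
  exact ⟨Nat.sSup_mem hne hbdd, fun _ h => le_csSup hbdd h⟩

/-- `Ext(m, F)`: the extremal matrices, those of `Avoid(m, F)` with `forb(m, F)` columns. -/
def Extremal (m : ℕ) {k l : ℕ} (F : Matrix (Fin k) (Fin l) (Fin 2)) :
    Set (Σ n : ℕ, Matrix (Fin m) (Fin n) (Fin 2)) :=
  {A | A ∈ Avoid m F ∧ A.1 = forb m F}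

/-- The `2 × (p + 1)` matrix `F(0, p, 1, 0)`: its first `p` columns are `(1, 0)`, its last column
is `(0, 1)`. -/
def configF (p : ℕ) : Matrix (Fin 2) (Fin (p + 1)) (Fin 2) :=
  Matrix.of fun i j => if (i = 0 ↔ (j : ℕ) < p) then 1 else 0

/-- The explicit `5 × 28` matrix `[K₅⁰ K₅¹ M K₅⁴ K₅⁵]`, where `M` consists of eight columns of
sum 2 and eight columns of sum 3. -/
def matrixE : Matrix (Fin 5) (Fin 28) (Fin 2) :=
  !![0, 1,0,0,0,0, 1,1,1,1,0,0,0,0, 1,1,1,1,0,0,0,0, 0,1,1,1,1, 1;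
     0, 0,1,0,0,0, 1,0,0,0,1,1,0,0, 1,1,0,0,1,1,1,0, 1,0,1,1,1, 1;
     0, 0,0,1,0,0, 0,1,0,0,1,0,1,0, 1,0,1,0,1,1,0,1, 1,1,0,1,1, 1;
     0, 0,0,0,1,0, 0,0,1,0,0,1,0,1, 0,0,1,1,1,0,1,1, 1,1,1,0,1, 1;
     0, 0,0,0,0,1, 0,0,0,1,0,0,1,1, 0,1,0,1,0,1,1,1, 1,1,1,1,0, 1]

/-- The `5t × (27t + 1)` block matrix with `t` row blocks of size 5 and `t` column blocks of size
27, followed by one more column. The diagonal blocks are `matrixE` without its last column (the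
column of 1's), all blocks above the diagonal and the last column are all 1's, and all blocks below
the diagonal are all 0's. (The last column has column block index `t`.) -/
def blockE (t : ℕ) : Matrix (Fin (5 * t)) (Fin (27 * t + 1)) (Fin 2) :=
  Matrix.of fun i j =>
    if (i : ℕ) / 5 < (j : ℕ) / 27 then 1
    else if (i : ℕ) / 5 = (j : ℕ) / 27 then
      matrixE ⟨(i : ℕ) % 5, Nat.mod_lt _ (by norm_num)⟩
        ⟨(j : ℕ) % 27, (Nat.mod_lt _ (by norm_num)).trans (by norm_num)⟩
    else 0

/-! ### Balanced set families: row sums, traces, double counting -/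

section Family

variable {α : Type*}

/-! Columns are read as the sets of rows in which they have a 1; avoiding the configuration then
says that the family is balanced. Since rowSum i − rowSum j = exceed i j − exceed j i, a row whose
sum is larger by at least 7 lies in every set that contains the smaller row
(`IsBalanced.mem_of_add_le`).

The bound 5|F| ≤ 27m + 5 is proved by induction on the number m of rows. In a minimal counterexample
consecutive row sums differ by at most 6, as the family splits at a larger gap
(`IsBalanced.card_le_of_gap`). Every row also has three others with sums within 6 of its own, since
otherwise its deletion loses at most 4 < 27/5 sets (`IsBalanced.card_double_le`). If the row sums
spread over at most 14, counting pairs (i ∈ S, j ∉ S) gives the bound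
(`IsBalanced.card_le_of_rowSum_le`).

Otherwise |F| is the least row sum, plus the spread of the row sums, plus the number of sets
avoiding the row of largest sum. The first and last terms are controlled by the numbers of rows near
the two extremes, at less than 27/5 per row. In between, sorted row sums grow by about 5 per row
(`le_add_of_three_close`), again below 27/5.

For the lower bound, two rows of different blocks of `blockE` are nested, and two rows of one block
differ only inside a copy of `matrixE`, where no row exceeds another more than 7 times. -/

theorem card_filter_card_eq_le {R : Finset α} {F : Finset (Finset α)} (hF : ∀ S ∈ F, S ⊆ R)
    (k : ℕ) : (F.filter fun S => S.card = k).card ≤ R.card.choose k := by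
  rw [← Finset.card_powersetCard]
  refine Finset.card_le_card fun S hS => ?_
  rw [Finset.mem_filter] at hS
  exact Finset.mem_powersetCard.2 ⟨hF S hS.1, hS.2⟩

theorem card_le_two_pow {R : Finset α} {F : Finset (Finset α)} (hF : ∀ S ∈ F, S ⊆ R) :
    F.card ≤ 2 ^ R.card := by
  rw [← Finset.card_powerset]
  exact Finset.card_le_card fun S hS => Finset.mem_powerset.2 (hF S hS)

variable [DecidableEq α]

/-- The number of members of `F` that contain `i` but not `j`. -/
def exceed (F : Finset (Finset α)) (i j : α) : ℕ :=
  (F.filter fun S => i ∈ S ∧ j ∉ S).card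

/-- The number of members of `F` that contain `i`. -/
def rowSum (F : Finset (Finset α)) (i : α) : ℕ :=
  (F.filter fun S => i ∈ S).card

/-- A family of subsets of `R` such that no two elements `i`, `j` of `R` have eight members
containing `i` but not `j` and one member containing `j` but not `i`. -/
def IsBalanced (R : Finset α) (F : Finset (Finset α)) : Prop :=
  (∀ S ∈ F, S ⊆ R) ∧ ∀ i ∈ R, ∀ j ∈ R, 8 ≤ exceed F i j → exceed F j i = 0

theorem rowSum_add_exceed (F : Finset (Finset α)) (i j : α) :
    rowSum F i + exceed F j i = rowSum F j + exceed F i j := by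
  have key : ∀ a b : α, rowSum F a = (F.filter fun S => a ∈ S ∧ b ∈ S).card + exceed F a b := by
    intro a b
    unfold rowSum exceed
    rw [← Finset.card_filter_add_card_filter_not (s := F.filter fun S => a ∈ S) (fun S => b ∈ S),
      Finset.filter_filter, Finset.filter_filter]
  have h : (F.filter fun S => i ∈ S ∧ j ∈ S) = F.filter fun S => j ∈ S ∧ i ∈ S := by
    simp only [and_comm]
  rw [key i j, key j i, h]
  ring

/-- If `exceed F j i` is nonzero, balance forces `exceed F i j ≤ 7`; the difference of the row sums
turns this into the second alternative, a form suited to `omega`. -/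
theorem IsBalanced.exceed_bound {R : Finset α} {F : Finset (Finset α)} (hF : IsBalanced R F)
    {i j : α} (hi : i ∈ R) (hj : j ∈ R) :
    exceed F j i = 0 ∨ exceed F j i + rowSum F i ≤ 7 + rowSum F j := by
  have h := rowSum_add_exceed F i j
  have h' := hF.2 i hi j hj
  omega

theorem mem_of_exceed_eq_zero {F : Finset (Finset α)} {i j : α} (h : exceed F i j = 0)
    {S : Finset α} (hS : S ∈ F) (hi : i ∈ S) : j ∈ S := by
  by_contra hj
  unfold exceed at h
  rw [Finset.card_eq_zero, Finset.filter_eq_empty_iff] at h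
  exact h hS ⟨hi, hj⟩

theorem IsBalanced.mem_of_add_le {R : Finset α} {F : Finset (Finset α)} (hF : IsBalanced R F)
    {i j : α} (hi : i ∈ R) (hj : j ∈ R) (h : rowSum F j + 7 ≤ rowSum F i)
    {S : Finset α} (hS : S ∈ F) (hjS : j ∈ S) : i ∈ S := by
  refine mem_of_exceed_eq_zero (i := j) ?_ hS hjS
  have := hF.exceed_bound hi hj
  omega

theorem exceed_trace_le (F : Finset (Finset α)) (T : Finset α) {i j : α} (hj : j ∈ T) :
    exceed (F.image (· ∩ T)) i j ≤ exceed F i j := by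
  unfold exceed
  refine (Finset.card_le_card ?_).trans
    (Finset.card_image_le (s := F.filter fun S => i ∈ S ∧ j ∉ S) (f := (· ∩ T)))
  intro X hX
  simp only [Finset.mem_filter, Finset.mem_image] at hX ⊢
  obtain ⟨⟨S, hS, rfl⟩, hi, hjS⟩ := hX
  simp only [Finset.mem_inter] at hi hjS
  exact ⟨S, ⟨hS, hi.1, fun h => hjS ⟨h, hj⟩⟩, rfl⟩

theorem IsBalanced.trace {R : Finset α} {F : Finset (Finset α)} (hF : IsBalanced R F)
    {T : Finset α} (hT : T ⊆ R) : IsBalanced T (F.image (· ∩ T)) := by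
  refine ⟨?_, fun i hi j hj h8 => ?_⟩
  · intro S hS
    obtain ⟨S, -, rfl⟩ := Finset.mem_image.1 hS
    exact Finset.inter_subset_right
  · have := hF.2 i (hT hi) j (hT hj) (h8.trans (exceed_trace_le F T hj))
    have := exceed_trace_le F T (i := j) hi
    omega

/-- Both sides count the triples (S, i, j) with i ∈ S and j ∈ R \ S. -/
theorem sum_card_mul_card_compl {R : Finset α} {F : Finset (Finset α)} (hF : ∀ S ∈ F, S ⊆ R) :
    ∑ S ∈ F, S.card * (R.card - S.card) = ∑ i ∈ R, ∑ j ∈ R, exceed F i j := by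
  have h1 : ∀ S ∈ F, S.card * (R.card - S.card) =
      ∑ i ∈ R, ∑ j ∈ R, if i ∈ S ∧ j ∉ S then 1 else 0 := by
    intro S hS
    have hR : R.card - S.card = (R.filter fun j => j ∉ S).card := by
      rw [← Finset.card_sdiff_of_subset (hF S hS), Finset.sdiff_eq_filter]
    have hS' : S.card = (R.filter fun i => i ∈ S).card := by
      rw [Finset.filter_mem_eq_inter, Finset.inter_eq_right.2 (hF S hS)]
    rw [hR, hS', Finset.card_filter, Finset.card_filter, Finset.sum_mul_sum]
    refine Finset.sum_congr rfl fun i _ => Finset.sum_congr rfl fun j _ => ?_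
    by_cases hi : i ∈ S <;> by_cases hj : j ∈ S <;> simp [hi, hj]
  rw [Finset.sum_congr rfl h1, Finset.sum_comm]
  refine Finset.sum_congr rfl fun i _ => ?_
  rw [Finset.sum_comm]
  refine Finset.sum_congr rfl fun j _ => ?_
  rw [exceed, Finset.card_filter]

theorem sum_exceed_le {R : Finset α} {F : Finset (Finset α)} {b : ℕ}
    (h : ∀ i ∈ R, ∀ j ∈ R, exceed F i j + exceed F j i ≤ 2 * b) :
    ∑ i ∈ R, ∑ j ∈ R, exceed F i j ≤ b * (R.card * (R.card - 1)) := by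
  have h2 : 2 * ∑ i ∈ R, ∑ j ∈ R, exceed F i j =
      ∑ i ∈ R, ∑ j ∈ R, (exceed F i j + exceed F j i) := by
    simp only [Finset.sum_add_distrib]
    rw [Finset.sum_comm (f := fun i j => exceed F j i), two_mul]
  have h3 : ∑ i ∈ R, ∑ j ∈ R, (exceed F i j + exceed F j i) ≤
      ∑ i ∈ R, ((R.card - 1) * (2 * b)) := by
    refine Finset.sum_le_sum fun i hi => ?_
    rw [← Finset.add_sum_erase R _ hi, ← Finset.card_erase_of_mem hi]
    have h0 : exceed F i i = 0 := by simp [exceed]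
    rw [h0, zero_add, zero_add, ← smul_eq_mul]
    exact Finset.sum_le_card_nsmul _ _ _ fun j hj => h i hi j (Finset.mem_of_mem_erase hj)
  rw [Finset.sum_const, smul_eq_mul] at h3
  have h4 : R.card * ((R.card - 1) * (2 * b)) = 2 * (b * (R.card * (R.card - 1))) := by ring
  omega

/-- The bound for families whose row sums all lie in an interval of length `14`. -/
theorem IsBalanced.card_le_of_rowSum_le {R : Finset α} {F : Finset (Finset α)}
    (hF : IsBalanced R F)
    (h : ∀ i ∈ R, ∀ j ∈ R, rowSum F i ≤ rowSum F j + 14) :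
    5 * F.card ≤ 27 * R.card + 5 := by
  obtain hm | hm := Nat.lt_or_ge R.card 5
  · have h2 := card_le_two_pow hF.1
    interval_cases R.card <;> omega
  obtain ⟨p, hp⟩ : ∃ p, R.card = p + 5 := ⟨R.card - 5, by omega⟩
  have hsum : ∑ S ∈ F, S.card * (R.card - S.card) ≤ 7 * (R.card * (R.card - 1)) := by
    rw [sum_card_mul_card_compl hF.1]
    -- Either both exceedances are at most 7, or one vanishes and the other is a difference of row
    -- sums, at most 14.
    refine sum_exceed_le fun i hi j hj => ?_
    have h1 := hF.exceed_bound hi hj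
    have h2 := hF.exceed_bound hj hi
    have h3 := rowSum_add_exceed F i j
    have h4 := h i hi j hj
    have h5 := h j hj i hi
    omega
  -- With m = p + 5, a set of size between 2 and m − 2 has weight at least 2(m − 2). Sizes 1 and m −
  -- 1 fall short by m − 3, sizes 0 and m by 2(m − 2).
  have hpt : ∀ S ∈ F, 2 * (p + 3) ≤ S.card * (R.card - S.card) +
      (((p + 2) * (if S.card = 1 then 1 else 0) + (p + 2) * (if S.card = p + 4 then 1 else 0)) +
      (2 * (p + 3) * (if S.card = 0 then 1 else 0) +
        2 * (p + 3) * (if S.card = p + 5 then 1 else 0))) := by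
    intro S hS
    have hle := Finset.card_le_card (hF.1 S hS)
    rw [hp] at hle ⊢
    generalize S.card = k at hle ⊢
    obtain rfl | hk0 := eq_or_ne k 0
    · simp
    obtain rfl | hk1 := eq_or_ne k 1
    · simp; omega
    obtain rfl | hk2 := eq_or_ne k (p + 4)
    · have : p + 5 - (p + 4) = 1 := by omega
      simp [this]; omega
    obtain rfl | hk3 := eq_or_ne k (p + 5)
    · simp
    obtain ⟨a, rfl⟩ : ∃ a, k = a + 2 := ⟨k - 2, by omega⟩
    obtain ⟨c, hc⟩ : ∃ c, p + 1 = a + c := ⟨p + 1 - a, by omega⟩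
    have hsub : p + 5 - (a + 2) = c + 2 := by omega
    rw [hsub]
    refine le_trans ?_ (Nat.le_add_right _ _)
    have : (a + 2) * (c + 2) = a * c + 2 * (a + c) + 4 := by ring
    have := Nat.zero_le (a * c)
    omega
  have htot := Finset.sum_le_sum hpt
  simp only [Finset.sum_add_distrib, ← Finset.mul_sum, ← Finset.card_filter, Finset.sum_const,
    smul_eq_mul] at htot
  have c0 := card_filter_card_eq_le hF.1 0
  have c1 := card_filter_card_eq_le hF.1 1
  have c2 := card_filter_card_eq_le hF.1 (p + 4)
  have c3 := card_filter_card_eq_le hF.1 (p + 5)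
  rw [hp] at c0 c1 c2 c3 hsum htot
  rw [Nat.choose_succ_self_right (p + 4)] at c2
  simp only [Nat.choose_zero_right, Nat.choose_one_right, Nat.choose_self] at c0 c1 c3
  have d1 := Nat.mul_le_mul_left (p + 2) c1
  have d2 := Nat.mul_le_mul_left (p + 2) c2
  have d0 := Nat.mul_le_mul_left (2 * (p + 3)) c0
  have d3 := Nat.mul_le_mul_left (2 * (p + 3)) c3
  have hfin : F.card * (2 * (p + 3)) ≤
      7 * ((p + 5) * (p + 4)) + 2 * ((p + 2) * (p + 5)) + 4 * (p + 3) := by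
    have : p + 5 - 1 = p + 4 := by omega
    rw [this] at hsum
    have e1 : (p + 2) * (p + 4 + 1) = (p + 2) * (p + 5) := rfl
    linarith
  rw [hp]
  -- For m = 5 the estimate reads 6|F| ≤ 172, and integrality is needed to reach 28.
  obtain rfl | hp0 := Nat.eq_zero_or_pos p
  · omega
  by_contra hcon
  push Not at hcon
  nlinarith

end Family

/-! ### Rows near the extreme sums, deletion of a row, gaps -/

section Family

variable {α : Type*} [DecidableEq α]

/-- A family of subsets of an `N`-set in which each element has degree at most `7`. -/
theorem card_le_of_rowSum_le_seven {N : Finset α} {G : Finset (Finset α)}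
    (hG : ∀ S ∈ G, S ⊆ N) (h : ∀ i ∈ N, rowSum G i ≤ 7) : G.card ≤ 4 * N.card + 1 := by
  have hsum : ∑ S ∈ G, S.card = ∑ i ∈ N, rowSum G i := by
    have h1 : ∀ S ∈ G, S.card = ∑ i ∈ N, if i ∈ S then 1 else 0 := by
      intro S hS
      rw [← Finset.card_filter, Finset.filter_mem_eq_inter, Finset.inter_eq_right.2 (hG S hS)]
    rw [Finset.sum_congr rfl h1, Finset.sum_comm]
    exact Finset.sum_congr rfl fun i _ => by rw [rowSum, Finset.card_filter]
  have h7 : ∑ i ∈ N, rowSum G i ≤ N.card * 7 := by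
    rw [← smul_eq_mul]
    exact Finset.sum_le_card_nsmul _ _ _ h
  -- Sets of size at least 2 have weight 2; the singletons and the empty set make up |N| + 2, so
  -- 2|G| ≤ 7|N| + |N| + 2.
  have hpt : ∀ S ∈ G, 2 ≤ S.card + ((if S.card = 1 then 1 else 0) +
      2 * (if S.card = 0 then 1 else 0)) := by
    intro S _
    split_ifs <;> omega
  have htot := Finset.sum_le_sum hpt
  simp only [Finset.sum_add_distrib, ← Finset.mul_sum, ← Finset.card_filter, Finset.sum_const,
    smul_eq_mul] at htot
  have c0 := card_filter_card_eq_le hG 0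
  have c1 := card_filter_card_eq_le hG 1
  simp only [Nat.choose_zero_right, Nat.choose_one_right] at c0 c1
  omega

/-- The estimate for the rows near either extreme of the row sums. -/
theorem five_mul_add_le_of_le_two_pow {G k : ℕ} (h1 : G ≤ 2 ^ k) (h2 : G ≤ 4 * k + 1) (hk : 3 ≤ k) :
    5 * G + 27 ≤ 27 * k := by
  -- The power of 2 is needed for k = 3 and k = 4, the linear bound from k = 5 on.
  obtain rfl | rfl | hk : k = 3 ∨ k = 4 ∨ 5 ≤ k := by omega
  all_goals omega

/-- The members avoiding a row `r` of maximal row sum. -/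
theorem IsBalanced.card_not_mem_le {R : Finset α} {F : Finset (Finset α)} (hF : IsBalanced R F)
    {r : α} (hr : r ∈ R) (hmax : ∀ j ∈ R, rowSum F j ≤ rowSum F r)
    (hk : 3 ≤ ((R.erase r).filter fun j => rowSum F r ≤ rowSum F j + 6).card) :
    5 * (F.filter fun S => r ∉ S).card + 27 ≤
      27 * ((R.erase r).filter fun j => rowSum F r ≤ rowSum F j + 6).card := by
  -- A row with sum at least 7 below that of `r` occurs only in sets containing `r`.
  have hG : ∀ S ∈ F.filter fun S => r ∉ S,
      S ⊆ (R.erase r).filter fun j => rowSum F r ≤ rowSum F j + 6 := by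
    intro S hS j hj
    rw [Finset.mem_filter] at hS
    have hjR := hF.1 S hS.1 hj
    rw [Finset.mem_filter, Finset.mem_erase]
    refine ⟨⟨fun h => hS.2 (h ▸ hj), hjR⟩, ?_⟩
    by_contra hcon
    exact hS.2 (hF.mem_of_add_le hr hjR (by omega) hS.1 hj)
  refine five_mul_add_le_of_le_two_pow (card_le_two_pow hG) (card_le_of_rowSum_le_seven hG fun i hi => ?_) hk
  rw [Finset.mem_filter, Finset.mem_erase] at hi
  have h1 := hF.exceed_bound hr hi.1.2
  have h2 := hmax i hi.1.2
  have h3 : rowSum (F.filter fun S => r ∉ S) i = exceed F i r := by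
    simp only [rowSum, exceed, Finset.filter_filter, and_comm]
  omega

/-- The members containing a row `r` of minimal row sum. -/
theorem IsBalanced.card_mem_le {R : Finset α} {F : Finset (Finset α)} (hF : IsBalanced R F)
    {r : α} (hr : r ∈ R) (hmin : ∀ j ∈ R, rowSum F r ≤ rowSum F j)
    (hk : 3 ≤ ((R.erase r).filter fun j => rowSum F j ≤ rowSum F r + 6).card) :
    5 * rowSum F r + 27 ≤
      27 * ((R.erase r).filter fun j => rowSum F j ≤ rowSum F r + 6).card := by
  set N := (R.erase r).filter fun j => rowSum F j ≤ rowSum F r + 6 with hN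
  -- Complements in `R` exchange the two extremes, so the argument for the maximal row applies.
  have hinj : Set.InjOn (fun S => R \ S) (F : Set (Finset α)) := by
    intro S hS T hT hST
    have := congrArg (fun X => R \ X) hST
    simpa [Finset.sdiff_sdiff_eq_self (hF.1 S hS), Finset.sdiff_sdiff_eq_self (hF.1 T hT)]
      using this
  have hinj' : Set.InjOn (fun S => R \ S) (F.filter fun S => r ∈ S : Set (Finset α)) :=
    hinj.mono fun S hS => (Finset.mem_filter.1 hS).1
  have hcard : ((F.filter fun S => r ∈ S).image fun S => R \ S).card = rowSum F r :=
    Finset.card_image_of_injOn (by simpa using hinj')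
  have hG : ∀ S ∈ (F.filter fun S => r ∈ S).image fun S => R \ S, S ⊆ N := by
    intro X hX j hj
    obtain ⟨S, hS, rfl⟩ := Finset.mem_image.1 hX
    rw [Finset.mem_filter] at hS
    rw [Finset.mem_sdiff] at hj
    rw [hN, Finset.mem_filter, Finset.mem_erase]
    refine ⟨⟨fun h => hj.2 (h ▸ hS.2), hj.1⟩, ?_⟩
    by_contra hcon
    exact hj.2 (hF.mem_of_add_le hj.1 hr (by omega) hS.1 hS.2)
  rw [← hcard]
  refine five_mul_add_le_of_le_two_pow (card_le_two_pow hG) (card_le_of_rowSum_le_seven hG fun i hi => ?_) hk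
  rw [hN, Finset.mem_filter, Finset.mem_erase] at hi
  have h1 := hF.exceed_bound hi.1.2 hr
  have h2 := hmin i hi.1.2
  have h3 : rowSum ((F.filter fun S => r ∈ S).image fun S => R \ S) i ≤ exceed F r i := by
    unfold rowSum exceed
    rw [Finset.filter_image, Finset.filter_filter]
    refine Finset.card_image_le.trans (Finset.card_le_card fun S hS => ?_)
    simp only [Finset.mem_filter, Finset.mem_sdiff] at hS ⊢
    exact ⟨hS.1, hS.2.1, hS.2.2.2⟩
  omega

/-- Deleting `r` identifies exactly the pairs S, S ∪ {r} with both members in `F`. -/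
theorem card_add_card_of_erase_image (F : Finset (Finset α)) (r : α) :
    F.card = (F.image fun S => S.erase r).card +
      (F.filter fun S => r ∉ S ∧ insert r S ∈ F).card := by
  have h1 := Finset.card_filter_add_card_filter_not (s := F) fun S => r ∈ S
  have e1 : ((F.filter fun S => r ∈ S).image fun S => S.erase r).card =
      (F.filter fun S => r ∈ S).card := by
    refine Finset.card_image_of_injOn fun S hS T hT h => ?_
    simp only [Finset.coe_filter, Set.mem_ofPred_eq] at hS hT
    rw [← Finset.insert_erase hS.2, ← Finset.insert_erase hT.2]
    exact congrArg (insert r) h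
  have e2 : (F.image fun S => S.erase r) =
      ((F.filter fun S => r ∈ S).image fun S => S.erase r) ∪ F.filter fun S => r ∉ S := by
    ext X
    simp only [Finset.mem_image, Finset.mem_union, Finset.mem_filter]
    constructor
    · rintro ⟨S, hS, rfl⟩
      by_cases hr : r ∈ S
      · exact Or.inl ⟨S, ⟨hS, hr⟩, rfl⟩
      · exact Or.inr (by rw [Finset.erase_eq_of_notMem hr]; exact ⟨hS, hr⟩)
    · rintro (⟨S, hS, rfl⟩ | hX)
      · exact ⟨S, hS.1, rfl⟩
      · exact ⟨X, hX.1, Finset.erase_eq_of_notMem hX.2⟩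
  have e3 : (((F.filter fun S => r ∈ S).image fun S => S.erase r) ∩ F.filter fun S => r ∉ S) =
      F.filter fun S => r ∉ S ∧ insert r S ∈ F := by
    ext X
    simp only [Finset.mem_image, Finset.mem_inter, Finset.mem_filter]
    constructor
    · rintro ⟨⟨S, hS, rfl⟩, hX⟩
      exact ⟨hX.1, hX.2, by rw [Finset.insert_erase hS.2]; exact hS.1⟩
    · rintro ⟨hX, hr, hi⟩
      exact ⟨⟨insert r X, ⟨hi, Finset.mem_insert_self _ _⟩, Finset.erase_insert hr⟩, hX, hr⟩
  have h2 := Finset.card_union_add_card_inter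
    ((F.filter fun S => r ∈ S).image fun S => S.erase r) (F.filter fun S => r ∉ S)
  rw [← e2, e3, e1] at h2
  omega

/-- The sets that occur both with and without `r` differ only on the rows whose row sum is
within `6` of that of `r`. -/
theorem IsBalanced.card_double_le {R : Finset α} {F : Finset (Finset α)} (hF : IsBalanced R F)
    {r : α} (hr : r ∈ R) :
    (F.filter fun S => r ∉ S ∧ insert r S ∈ F).card ≤
      2 ^ ((R.erase r).filter fun j =>
        rowSum F j ≤ rowSum F r + 6 ∧ rowSum F r ≤ rowSum F j + 6).card := by
  set N := (R.erase r).filter fun j =>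
    rowSum F j ≤ rowSum F r + 6 ∧ rowSum F r ≤ rowSum F j + 6 with hN
  rw [← Finset.card_powerset]
  refine Finset.card_le_card_of_injOn (fun S => S ∩ N)
    (fun S _ => Finset.mem_powerset.2 Finset.inter_subset_right) fun S hS T hT h => ?_
  simp only [Finset.coe_filter, Set.mem_ofPred_eq] at hS hT
  have key : ∀ S T : Finset α, S ∈ F ∧ r ∉ S ∧ insert r S ∈ F →
      T ∈ F ∧ r ∉ T ∧ insert r T ∈ F → S ∩ N = T ∩ N → S ⊆ T := by
    intro S T hS hT h j hj
    have hjR := hF.1 S hS.1 hj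
    have hjr : j ≠ r := fun e => hS.2.1 (e ▸ hj)
    by_cases hjN : j ∈ N
    · have : j ∈ T ∩ N := h ▸ Finset.mem_inter.2 ⟨hj, hjN⟩
      exact (Finset.mem_inter.1 this).1
    · rw [hN, Finset.mem_filter, Finset.mem_erase] at hjN
      -- A row far below `r` is missing from S, which avoids `r`; a row far above `r` lies in T,
      -- because insert r T contains `r`.
      obtain h7 | h7 : rowSum F j + 7 ≤ rowSum F r ∨ rowSum F r + 7 ≤ rowSum F j := by
        by_contra hcon
        exact hjN ⟨⟨hjr, hjR⟩, by omega, by omega⟩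
      · exact absurd (hF.mem_of_add_le hr hjR h7 hS.1 hj) hS.2.1
      · have := hF.mem_of_add_le hjR hr h7 hT.2.2 (Finset.mem_insert_self _ _)
        exact Finset.mem_of_mem_insert_of_ne this hjr
  exact Finset.Subset.antisymm (key S T hS hT h) (key T S hT hS h.symm)

/-- Splitting at a gap of the row sums. -/
theorem IsBalanced.card_le_of_gap {R : Finset α} {F : Finset (Finset α)} (hF : IsBalanced R F)
    (v : ℕ) (hgap : ∀ j ∈ R, rowSum F j ≤ v ∨ v + 7 ≤ rowSum F j)
    (hlow : ∃ j ∈ R, rowSum F j ≤ v) (hhigh : ∃ j ∈ R, v + 7 ≤ rowSum F j)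
    (ih : ∀ T : Finset α, T.card < R.card → ∀ G, IsBalanced T G → 5 * G.card ≤ 27 * T.card + 5) :
    5 * F.card ≤ 27 * R.card + 5 := by
  set T := R.filter fun j => v + 7 ≤ rowSum F j with hT
  set U := R.filter fun j => ¬ v + 7 ≤ rowSum F j with hU
  have hTU : T.card + U.card = R.card := Finset.card_filter_add_card_filter_not _
  have hTpos : 0 < T.card := by
    obtain ⟨j, hj, h⟩ := hhigh
    exact Finset.card_pos.2 ⟨j, Finset.mem_filter.2 ⟨hj, h⟩⟩
  have hUpos : 0 < U.card := by
    obtain ⟨j, hj, h⟩ := hlow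
    exact Finset.card_pos.2 ⟨j, Finset.mem_filter.2 ⟨hj, by omega⟩⟩
  have hTR : T ⊆ R := Finset.filter_subset _ _
  have hUR : U ⊆ R := Finset.filter_subset _ _
  -- A set containing one low row contains all high rows, so each member contains T or is contained
  -- in T.
  have hfull : ∀ S ∈ F, ¬ T ⊆ S → S ⊆ T := by
    intro S hS hTS j hj
    have hjR := hF.1 S hS hj
    by_contra hjT
    refine hTS fun i hi => ?_
    rw [hT, Finset.mem_filter] at hi hjT
    have := hgap j hjR
    have hjv : rowSum F j ≤ v := this.resolve_right fun h => hjT ⟨hjR, h⟩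
    exact hF.mem_of_add_le hi.1 hjR (by omega) hS hj
  have hsplit := Finset.card_filter_add_card_filter_not (s := F) fun S => T ⊆ S
  have hb : (F.filter fun S => T ⊆ S).card ≤ (F.image (· ∩ U)).card := by
    refine Finset.card_le_card_of_injOn (· ∩ U)
      (fun S hS => Finset.mem_image_of_mem _ (Finset.mem_filter.1 hS).1) fun S hS S' hS' h => ?_
    simp only [Finset.coe_filter, Set.mem_ofPred_eq] at hS hS'
    have key : ∀ S S' : Finset α, S ∈ F → T ⊆ S' → S ∩ U = S' ∩ U → S ⊆ S' := by
      intro S S' hS hS' h j hj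
      by_cases hjT : j ∈ T
      · exact hS' hjT
      · have hjU : j ∈ U := by
          have hjR := hF.1 S hS hj
          rw [hT, Finset.mem_filter] at hjT
          exact Finset.mem_filter.2 ⟨hjR, fun h => hjT ⟨hjR, h⟩⟩
        have : j ∈ S' ∩ U := h ▸ Finset.mem_inter.2 ⟨hj, hjU⟩
        exact (Finset.mem_inter.1 this).1
    exact Finset.Subset.antisymm (key S S' hS.1 hS'.2 h) (key S' S hS'.1 hS.2 h.symm)
  have hbU := ih U (by omega) _ (hF.trace hUR)
  have ha : F.filter (fun S => ¬ T ⊆ S) ⊆ (F.image (· ∩ T)).erase T := by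
    intro S hS
    rw [Finset.mem_filter] at hS
    have hST := hfull S hS.1 hS.2
    rw [Finset.mem_erase, Finset.mem_image]
    exact ⟨fun h => hS.2 h.ge, S, hS.1, Finset.inter_eq_left.2 hST⟩
  have ha' := Finset.card_le_card ha
  have haT := ih T (by omega) _ (hF.trace hTR)
  -- The two inductive bounds add up to 5 too much. When some member contains T, the trace on T
  -- includes T itself, which is not needed for the proper subsets of T and saves the 5.
  obtain h0 | h0 := Nat.eq_zero_or_pos (F.filter fun S => T ⊆ S).card
  · have := Finset.card_erase_le (s := F.image (· ∩ T)) (a := T)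
    omega
  · obtain ⟨S, hS⟩ := Finset.card_pos.1 h0
    rw [Finset.mem_filter] at hS
    have hmem : T ∈ F.image (· ∩ T) := Finset.mem_image.2 ⟨S, hS.1, Finset.inter_eq_right.2 hS.2⟩
    have := Finset.card_erase_add_one hmem
    omega

end Family

/-! ### Growth of the sorted row sums -/

section Span

/-- A sequence of `m` values with gaps at most `6` in which every value has three others within
distance `6` increases by at most `5` per step, up to a constant. -/
theorem le_add_of_three_close {m : ℕ} {t : ℕ → ℕ} (hmono : ∀ i j, i ≤ j → j < m → t i ≤ t j)
    (hgap : ∀ i, i + 1 < m → t (i + 1) ≤ t i + 6)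
    (hclose : ∀ q < m,
      3 ≤ (((Finset.range m).erase q).filter fun j => t j ≤ t q + 6 ∧ t q ≤ t j + 6).card)
    (d a : ℕ) (had : a + d < m) : t (a + d) ≤ t a + 5 * d + 5 := by
  -- If six steps gain more than 30, only a + 2 and a + 4 can be close to a + 3: a three-step half
  -- gains at most 18, so each half gains at least 13, and the gap bound puts a + 1 and a + 5 at
  -- distance at least 7.
  have hsix : ∀ a, a + 6 < m → t (a + 6) ≤ t a + 30 := by
    intro a ha
    have g0 := hgap a (by omega)
    have g1 : t (a + 2) ≤ t (a + 1) + 6 := hgap (a + 1) (by omega)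
    have g2 : t (a + 3) ≤ t (a + 2) + 6 := hgap (a + 2) (by omega)
    have g3 : t (a + 4) ≤ t (a + 3) + 6 := hgap (a + 3) (by omega)
    have g4 : t (a + 5) ≤ t (a + 4) + 6 := hgap (a + 4) (by omega)
    have g5 : t (a + 6) ≤ t (a + 5) + 6 := hgap (a + 5) (by omega)
    by_contra hcon
    have h3 := hclose (a + 3) (by omega)
    have hmem : ∀ j ∈ ((Finset.range m).erase (a + 3)).filter fun j =>
        t j ≤ t (a + 3) + 6 ∧ t (a + 3) ≤ t j + 6,
        (j = a + 1 ∨ j = a + 2 ∨ j = a + 4 ∨ j = a + 5) ∧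
          t j ≤ t (a + 3) + 6 ∧ t (a + 3) ≤ t j + 6 := by
      intro j hj
      simp only [Finset.mem_filter, Finset.mem_erase, Finset.mem_range] at hj
      refine ⟨?_, hj.2⟩
      have hlow : a + 1 ≤ j := by
        by_contra hlt
        have := hmono j a (by omega) (by omega)
        omega
      have hhigh : j ≤ a + 5 := by
        by_contra hlt
        have := hmono (a + 6) j (by omega) hj.1.2
        omega
      omega
    have htwo : ∀ x y, (∀ j, (j = a + 1 ∨ j = a + 2 ∨ j = a + 4 ∨ j = a + 5) →
        t j ≤ t (a + 3) + 6 → t (a + 3) ≤ t j + 6 → j = x ∨ j = y) → False := by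
      intro x y hxy
      have hsub : (((Finset.range m).erase (a + 3)).filter fun j =>
          t j ≤ t (a + 3) + 6 ∧ t (a + 3) ≤ t j + 6) ⊆ {x, y} := by
        intro j hj
        obtain ⟨h1, h2, h3⟩ := hmem j hj
        simpa using hxy j h1 h2 h3
      have := (Finset.card_le_card hsub).trans Finset.card_le_two
      omega
    by_cases h5 : t (a + 5) ≤ t (a + 3) + 6
    · refine htwo (a + 4) (a + 5) ?_
      rintro j (rfl | rfl | rfl | rfl) <;> intros <;> omega
    by_cases h1 : t (a + 3) ≤ t (a + 1) + 6
    · refine htwo (a + 1) (a + 2) ?_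
      rintro j (rfl | rfl | rfl | rfl) <;> intros <;> omega
    · refine htwo (a + 2) (a + 4) ?_
      rintro j (rfl | rfl | rfl | rfl) <;> intros <;> omega
  induction d using Nat.strong_induction_on generalizing a with
  | _ d ih =>
    -- For d ≤ 5 the gaps give 6d ≤ 5d + 5, which is the source of the additive 5.
    obtain hd | hd := Nat.lt_or_ge d 6
    · have hsmall : ∀ k, a + k < m → t (a + k) ≤ t a + 6 * k := by
        intro k
        induction k with
        | zero => intro _; simp
        | succ k ihk =>
          intro hk
          have := ihk (by omega)
          have := hgap (a + k) (by omega)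
          rw [← add_assoc]
          omega
      have := hsmall d had
      omega
    · have h1 := hsix a (by omega)
      have h2 := ih (d - 6) (by omega) (a + 6) (by omega)
      have : a + 6 + (d - 6) = a + d := by omega
      rw [this] at h2
      omega

end Span

/-! ### The upper bound for balanced families -/

section Family

variable {α : Type*} [DecidableEq α]

omit [DecidableEq α] in
theorem exists_sorted_enumeration {R : Finset α} (hR : R.Nonempty) (s : α → ℕ) :
    ∃ e : ℕ → α, (∀ i < R.card, e i ∈ R) ∧ (∀ x ∈ R, ∃ i < R.card, e i = x) ∧
      (∀ i < R.card, ∀ j < R.card, e i = e j → i = j) ∧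
      ∀ i j, i ≤ j → j < R.card → s (e i) ≤ s (e j) := by
  obtain ⟨r₀, -⟩ := hR
  let f : Fin R.card → α := fun i => R.equivFin.symm i
  have hf : Function.Injective f := fun i j h => R.equivFin.symm.injective (Subtype.ext h)
  let σ := Tuple.sort (s ∘ f)
  have hσ : Monotone ((s ∘ f) ∘ σ) := Tuple.monotone_sort _
  have he : ∀ i (hi : i < R.card),
      (fun i => if h : i < R.card then f (σ ⟨i, h⟩) else r₀) i = f (σ ⟨i, hi⟩) :=
    fun i hi => dif_pos hi
  refine ⟨fun i => if h : i < R.card then f (σ ⟨i, h⟩) else r₀, ?_, ?_, ?_, ?_⟩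
  · intro i hi
    rw [he i hi]
    exact (R.equivFin.symm _).2
  · intro x hx
    refine ⟨σ.symm (R.equivFin ⟨x, hx⟩), Fin.is_lt _, ?_⟩
    rw [he _ (Fin.is_lt _)]
    simp [f]
  · intro i hi j hj h
    rw [he i hi, he j hj] at h
    simpa using σ.injective (hf h)
  · intro i j hij hj
    rw [he i (hij.trans_lt hj), he j hj]
    exact hσ (show (⟨i, hij.trans_lt hj⟩ : Fin R.card) ≤ ⟨j, hj⟩ from hij)

/-- A balanced family on `m` rows has at most `27 m / 5 + 1` members. -/
theorem IsBalanced.card_le {R : Finset α} {F : Finset (Finset α)} (hF : IsBalanced R F) :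
    5 * F.card ≤ 27 * R.card + 5 := by
  induction hm : R.card using Nat.strong_induction_on generalizing R F with
  | _ m ih =>
  subst hm
  replace ih : ∀ T : Finset α, T.card < R.card → ∀ G, IsBalanced T G →
      5 * G.card ≤ 27 * T.card + 5 := fun T hT G hG => ih T.card hT hG rfl
  by_contra hcon
  have hgapF := fun v h1 h2 h3 => hcon (hF.card_le_of_gap v h1 h2 h3 ih)
  -- With at most two close rows at most 4 sets are doubled, and 5 · 4 ≤ 27 completes the induction.
  have hclose : ∀ r ∈ R, 3 ≤ ((R.erase r).filter fun j =>
      rowSum F j ≤ rowSum F r + 6 ∧ rowSum F r ≤ rowSum F j + 6).card := by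
    intro r hr
    have hlt := Finset.card_erase_add_one hr
    have h1 := ih (R.erase r) (by omega) _ (hF.trace (Finset.erase_subset r R))
    have h2 : (F.image (· ∩ R.erase r)) = F.image fun S => S.erase r := by
      refine Finset.image_congr fun S hS => ?_
      show S ∩ R.erase r = S.erase r
      rw [Finset.inter_erase, Finset.inter_eq_left.2 (hF.1 S hS)]
    rw [h2] at h1
    have h3 := card_add_card_of_erase_image F r
    have h4 := hF.card_double_le hr
    by_contra hk
    have h5 := h4.trans (Nat.pow_le_pow_right (n := 2) (by norm_num) (Nat.lt_succ_iff.1 (not_le.1 hk)))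
    omega
  obtain ⟨x, hx, y, hy, hxy⟩ : ∃ x ∈ R, ∃ y ∈ R, rowSum F y + 14 < rowSum F x := by
    by_contra hno
    push Not at hno
    exact hcon (hF.card_le_of_rowSum_le fun i hi j hj => hno i hi j hj)
  have hpos : 0 < R.card := Finset.card_pos.2 ⟨x, hx⟩
  obtain ⟨e, heR, hsurj, hinj, hmono⟩ := exists_sorted_enumeration ⟨x, hx⟩ (rowSum F)
  have hcount : ∀ q < R.card, ∀ (p : α → Prop) [DecidablePred p],
      ((R.erase (e q)).filter p).card =
        (((Finset.range R.card).erase q).filter fun i => p (e i)).card := by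
    intro q hq p _
    symm
    refine Finset.card_bij (fun i _ => e i) ?_ ?_ ?_
    · intro i hi
      simp only [Finset.mem_filter, Finset.mem_erase, Finset.mem_range] at hi ⊢
      exact ⟨⟨fun h => hi.1.1 (hinj i hi.1.2 q hq h), heR i hi.1.2⟩, hi.2⟩
    · intro i hi j hj h
      simp only [Finset.mem_filter, Finset.mem_erase, Finset.mem_range] at hi hj
      exact hinj i hi.1.2 j hj.1.2 h
    · intro z hz
      simp only [Finset.mem_filter, Finset.mem_erase, Finset.mem_range] at hz ⊢
      obtain ⟨i, hi, rfl⟩ := hsurj z hz.1.2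
      exact ⟨i, ⟨⟨fun h => hz.1.1 (h ▸ rfl), hi⟩, hz.2⟩, rfl⟩
  have hmax : ∀ j ∈ R, rowSum F j ≤ rowSum F (e (R.card - 1)) := by
    intro j hj
    obtain ⟨i, hi, rfl⟩ := hsurj j hj
    exact hmono i _ (by omega) (by omega)
  have hmin : ∀ j ∈ R, rowSum F (e 0) ≤ rowSum F j := by
    intro j hj
    obtain ⟨i, hi, rfl⟩ := hsurj j hj
    exact hmono 0 i (by omega) hi
  have htop := heR (R.card - 1) (by omega)
  have hbot := heR 0 hpos
  have hspan := le_add_of_three_close (m := R.card) (t := fun i => rowSum F (e i)) hmono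
    (by
      intro i hi
      by_contra hlt
      push Not at hlt
      refine hgapF (rowSum F (e i)) (fun j hj => ?_) ⟨e i, heR i (by omega), le_rfl⟩
        ⟨e (i + 1), heR _ hi, hlt⟩
      obtain ⟨k, hk, rfl⟩ := hsurj j hj
      obtain h | h := Nat.lt_or_ge k (i + 1)
      · exact Or.inl (hmono k i (by omega) (by omega))
      · exact Or.inr (le_trans hlt (hmono (i + 1) k h hk)))
    (by
      intro q hq
      have := hclose (e q) (heR q hq)
      rwa [hcount q hq] at this)
  have hk1 : 3 ≤ ((R.erase (e (R.card - 1))).filter fun j =>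
      rowSum F (e (R.card - 1)) ≤ rowSum F j + 6).card :=
    (hclose _ htop).trans (Finset.card_le_card fun j hj => by
      rw [Finset.mem_filter] at hj ⊢
      exact ⟨hj.1, hj.2.2⟩)
  have hk2 : 3 ≤ ((R.erase (e 0)).filter fun j => rowSum F j ≤ rowSum F (e 0) + 6).card :=
    (hclose _ hbot).trans (Finset.card_le_card fun j hj => by
      rw [Finset.mem_filter] at hj ⊢
      exact ⟨hj.1, hj.2.1⟩)
  have b1 := hF.card_not_mem_le htop hmax hk1
  have b2 := hF.card_mem_le hbot hmin hk2
  rw [hcount _ (by omega)] at b1 hk1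
  rw [hcount _ hpos] at b2 hk2
  have hn := Finset.card_filter_add_card_filter_not (s := F) fun S => e (R.card - 1) ∈ S
  change rowSum F (e (R.card - 1)) + _ = _ at hn
  have hx' := hmax x hx
  have hy' := hmin y hy
  have w1 : (((Finset.range R.card).erase (R.card - 1)).filter fun i =>
      rowSum F (e (R.card - 1)) ≤ rowSum F (e i) + 6).card ≤ R.card - 1 := by
    refine (Finset.card_filter_le _ _).trans ?_
    rw [Finset.card_erase_of_mem (by simpa using hpos), Finset.card_range]
  have w2 : (((Finset.range R.card).erase 0).filter fun i =>
      rowSum F (e i) ≤ rowSum F (e 0) + 6).card ≤ R.card - 1 := by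
    refine (Finset.card_filter_le _ _).trans ?_
    rw [Finset.card_erase_of_mem (by simpa using hpos), Finset.card_range]
  generalize hK1 : (((Finset.range R.card).erase (R.card - 1)).filter fun i =>
    rowSum F (e (R.card - 1)) ≤ rowSum F (e i) + 6).card = k₁ at b1 hk1 w1
  generalize hK2 : (((Finset.range R.card).erase 0).filter fun i =>
    rowSum F (e i) ≤ rowSum F (e 0) + 6).card = k₂ at b2 hk2 w2
  -- Were this to fail, the close rows would lie among the k₁ − 1 indices just below the top one.
  have u1 : rowSum F (e (R.card - 1)) ≤ rowSum F (e (R.card - 1 - k₁)) + 6 := by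
    by_contra hlt
    have hsub : (((Finset.range R.card).erase (R.card - 1)).filter fun i =>
        rowSum F (e (R.card - 1)) ≤ rowSum F (e i) + 6) ⊆
        Finset.Ico (R.card - k₁) (R.card - 1) := by
      intro i hi
      simp only [Finset.mem_filter, Finset.mem_erase, Finset.mem_range] at hi
      rw [Finset.mem_Ico]
      refine ⟨?_, by omega⟩
      by_contra hi'
      have := hmono i (R.card - 1 - k₁) (by omega) (by omega)
      omega
    have := Finset.card_le_card hsub
    rw [hK1, Nat.card_Ico] at this
    omega
  have u2 : rowSum F (e k₂) ≤ rowSum F (e 0) + 6 := by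
    by_contra hlt
    have hsub : (((Finset.range R.card).erase 0).filter fun i =>
        rowSum F (e i) ≤ rowSum F (e 0) + 6) ⊆ Finset.Ico 1 k₂ := by
      intro i hi
      simp only [Finset.mem_filter, Finset.mem_erase, Finset.mem_range] at hi
      rw [Finset.mem_Ico]
      refine ⟨by omega, ?_⟩
      by_contra hi'
      have := hmono k₂ i (by omega) (by omega)
      omega
    have := Finset.card_le_card hsub
    rw [hK2, Nat.card_Ico] at this
    omega
  -- If the two ranges crossed, the spread would be at most 6 + 6, contrary to the spread above 14.
  have hab : k₂ ≤ R.card - 1 - k₁ := by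
    by_contra hlt
    have := hmono (R.card - 1 - k₁) k₂ (by omega) (by omega)
    omega
  -- The spread is at most 5(m − 1 − k₁ − k₂) + 5 + 6 + 6, hence 5|F| ≤ 27(k₁ + k₂) − 54 + 25(m − 1
  -- − k₁ − k₂) + 85 ≤ 27m + 4.
  have hs := hspan (R.card - 1 - k₁ - k₂) k₂ (by omega)
  have : k₂ + (R.card - 1 - k₁ - k₂) = R.card - 1 - k₁ := by omega
  simp only [this] at hs
  omega

end Family

/-! ### Translation to matrices and the block construction -/

section Matrices

theorem forb_configF_eight_le (m : ℕ) : 5 * forb m (configF 8) ≤ 27 * m + 5 := by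
  obtain ⟨⟨n, A⟩, ⟨hA, hconf⟩, hn⟩ := (isGreatest_forb m (Nat.succ_pos 8) (configF 8)).1
  simp only at hA hconf hn
  rw [← hn]
  let col : Fin n → Finset (Fin m) := fun j => Finset.univ.filter fun i => A i j = 1
  have hcol : Function.Injective col := by
    intro j k h
    refine hA (funext fun i => ?_)
    have h1 : i ∈ col j ↔ i ∈ col k := by rw [h]
    simp only [col, Finset.mem_filter, Finset.mem_univ, true_and] at h1
    simp only [Matrix.transpose_apply]
    revert h1
    generalize A i j = x
    generalize A i k = y
    revert x y
    decide
  have hex : ∀ i j, exceed (Finset.univ.image col) i j =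
      (Finset.univ.filter fun c => A i c = 1 ∧ A j c ≠ 1).card := by
    intro i j
    unfold exceed
    rw [Finset.filter_image, Finset.card_image_of_injective _ hcol]
    simp [col]
  have hbal : IsBalanced Finset.univ (Finset.univ.image col) := by
    refine ⟨fun S _ => Finset.subset_univ S, fun i _ j _ h8 => ?_⟩
    rw [hex] at h8 ⊢
    by_contra hne
    obtain ⟨c₀, hc₀⟩ := Finset.card_pos.1 (Nat.pos_of_ne_zero hne)
    rw [Finset.mem_filter] at hc₀
    obtain ⟨T, hT, hTc⟩ := Finset.exists_subset_card_eq h8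
    have hij : i ≠ j := fun h => hc₀.2.2 (h ▸ hc₀.2.1)
    let f := T.orderEmbOfFin hTc
    have hf : ∀ k, A i (f k) = 1 ∧ A j (f k) ≠ 1 := fun k =>
      (Finset.mem_filter.1 (hT (T.orderEmbOfFin_mem hTc k))).2
    -- Eight columns where row i exceeds row j, followed by one column of the opposite kind, form
    -- the configuration.
    refine hconf ⟨⟨![i, j], ?_⟩, ⟨Fin.snoc f c₀, ?_⟩, ?_⟩
    · intro a b hab
      fin_cases a <;> fin_cases b <;> simp_all
    · rw [Fin.snoc_injective_iff]
      refine ⟨f.injective, ?_⟩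
      rintro ⟨k, hk⟩
      exact hc₀.2.2 (hk ▸ (hf k).1)
    · have hne1 : ∀ x : Fin 2, x ≠ 1 → x = 0 := by decide
      have hval : ∀ a b, A (![i, j] a) (Fin.snoc (α := fun _ => Fin n) f c₀ b) =
          configF 8 a b := by
        intro a b
        refine Fin.lastCases ?_ (fun k => ?_) b
        · rw [Fin.snoc_last]
          fin_cases a
          · simpa [configF] using hne1 _ hc₀.2.2
          · simpa [configF] using hc₀.2.1
        · rw [Fin.snoc_castSucc]
          fin_cases a
          · simpa [configF] using (hf k).1
          · simpa [configF] using hne1 _ (hf k).2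
      exact Matrix.ext hval
  have := hbal.card_le
  rw [Finset.card_image_of_injective _ hcol] at this
  simpa using this

theorem IsConfiguration.exists_rows {R C : Type*} [Fintype C] [DecidableEq C]
    {A : Matrix R C (Fin 2)} {p : ℕ} (h : IsConfiguration (configF p) A) :
    ∃ i j, p ≤ (Finset.univ.filter fun c => A i c = 1 ∧ A j c = 0).card ∧
      ∃ c, A i c = 0 ∧ A j c = 1 := by
  obtain ⟨r, c, h⟩ := h
  have hv : ∀ a b, A (r a) (c b) = configF p a b := fun a b => by rw [← h]; rfl
  refine ⟨r 0, r 1, ?_, c (Fin.last p), ?_, ?_⟩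
  · have := Finset.card_le_card_of_injOn (s := (Finset.univ : Finset (Fin p)))
      (t := Finset.univ.filter fun d => A (r 0) d = 1 ∧ A (r 1) d = 0)
      (fun k => c k.castSucc) (fun k _ => by simp [hv, configF])
      (fun k _ l _ hkl => by simpa using hkl)
    simpa using this
  · simp [hv, configF]
  · simp [hv, configF]

theorem matrixE_transpose_injective : Function.Injective matrixE.transpose := by
  have h : ∀ j k : Fin 28, (∀ i, matrixE i j = matrixE i k) → j = k := by decide +kernel
  exact fun j k hjk => h j k fun i => congrFun hjk i

theorem card_matrixE_le : ∀ i j : Fin 5,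
    (Finset.univ.filter fun c => matrixE i c = 1 ∧ matrixE j c = 0).card ≤ 7 := by
  decide +kernel

theorem matrixE_mem_Avoid :
    (⟨28, matrixE⟩ : Σ n : ℕ, Matrix (Fin 5) (Fin n) (Fin 2)) ∈ Avoid 5 (configF 8) := by
  refine ⟨matrixE_transpose_injective, fun h => ?_⟩
  obtain ⟨i, j, h8, -⟩ := h.exists_rows
  have := card_matrixE_le i j
  simp only at h8
  omega

theorem blockE_of_lt {t : ℕ} {i : Fin (5 * t)} {j : Fin (27 * t + 1)}
    (h : (i : ℕ) / 5 < (j : ℕ) / 27) : blockE t i j = 1 := by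
  simp [blockE, h]

theorem blockE_of_gt {t : ℕ} {i : Fin (5 * t)} {j : Fin (27 * t + 1)}
    (h : (j : ℕ) / 27 < (i : ℕ) / 5) : blockE t i j = 0 := by
  simp [blockE, h.not_gt, h.ne']

/-- The column of `matrixE` corresponding to a column of `blockE` within its block. -/
def colE (n : ℕ) : Fin 28 := ⟨n % 27, (Nat.mod_lt _ (by norm_num)).trans (by norm_num)⟩

/-- The row of `matrixE` corresponding to a row of `blockE` within its block. -/
def rowE (n : ℕ) : Fin 5 := ⟨n % 5, Nat.mod_lt _ (by norm_num)⟩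

theorem blockE_of_eq {t : ℕ} {i : Fin (5 * t)} {j : Fin (27 * t + 1)}
    (h : (i : ℕ) / 5 = (j : ℕ) / 27) : blockE t i j = matrixE (rowE i) (colE j) := by
  simp [blockE, h, rowE, colE]

theorem exists_rowE {t : ℕ} {k : ℕ} (hk : k < t) (a : Fin 5) :
    ∃ i : Fin (5 * t), (i : ℕ) / 5 = k ∧ rowE i = a := by
  have ha := a.2
  refine ⟨⟨5 * k + a, by omega⟩, ?_, ?_⟩
  · show (5 * k + (a : ℕ)) / 5 = k
    omega
  · ext
    show (5 * k + (a : ℕ)) % 5 = a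
    omega

theorem isSimple_blockE (t : ℕ) : IsSimple (blockE t) := by
  -- A column equal to one from a later block would be all 1's within its own block, but that column
  -- of `matrixE` has been deleted.
  have hone : ∀ c : Fin 28, (∀ a, matrixE a c = 1) → (c : ℕ) = 27 := by decide +kernel
  have hlt : ∀ j k : Fin (27 * t + 1), (blockE t).transpose j = (blockE t).transpose k →
      ¬ (j : ℕ) / 27 < (k : ℕ) / 27 := by
    intro j k h hjk
    have hk := k.2
    have hjt : (j : ℕ) / 27 < t := by omega
    have : (colE j : ℕ) = 27 := hone _ fun a => by
      obtain ⟨i, hi, rfl⟩ := exists_rowE hjt a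
      rw [← blockE_of_eq hi]
      have := congrFun h i
      simp only [Matrix.transpose_apply] at this
      rw [this]
      exact blockE_of_lt (by omega)
    have : (j : ℕ) % 27 = 27 := this
    omega
  intro j k h
  have h1 := hlt j k h
  have h2 := hlt k j h.symm
  have hj := j.2
  have hk := k.2
  obtain hjt | hjt := Nat.lt_or_ge ((j : ℕ) / 27) t
  · have hcol : colE j = colE k := by
      refine matrixE_transpose_injective (funext fun a => ?_)
      obtain ⟨i, hi, rfl⟩ := exists_rowE hjt a
      have := congrFun h i
      simp only [Matrix.transpose_apply] at this ⊢
      rwa [blockE_of_eq hi, blockE_of_eq (by omega)] at this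
    have hmod : (j : ℕ) % 27 = (k : ℕ) % 27 := congrArg Fin.val hcol
    exact Fin.ext (by omega)
  · exact Fin.ext (by omega)

theorem blockE_mem_Avoid (t : ℕ) :
    (⟨27 * t + 1, blockE t⟩ : Σ n : ℕ, Matrix (Fin (5 * t)) (Fin n) (Fin 2)) ∈
      Avoid (5 * t) (configF 8) := by
  refine ⟨isSimple_blockE t, fun h => ?_⟩
  obtain ⟨i, i', h8, c, hc, hc'⟩ := h.exists_rows
  simp only at h8 hc hc'
  have hne : (0 : Fin 2) ≠ 1 := by decide
  -- A 1 in row a over a 0 in row b puts the column block between the two row blocks. Both orders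
  -- occur in the configuration, so the two rows share a block and all columns counted lie in it.
  have hdiff : ∀ (a b : Fin (5 * t)) (d : Fin (27 * t + 1)), blockE t a d = 1 →
      blockE t b d = 0 → (a : ℕ) / 5 ≤ (d : ℕ) / 27 ∧ (d : ℕ) / 27 ≤ (b : ℕ) / 5 := by
    intro a b d ha hb
    refine ⟨?_, ?_⟩ <;> by_contra hlt <;> push Not at hlt
    · rw [blockE_of_gt hlt] at ha
      exact hne ha
    · rw [blockE_of_lt hlt] at hb
      exact hne hb.symm
  have h1 := hdiff _ _ _ hc' hc
  obtain ⟨d, hd⟩ := Finset.card_pos.1 ((Nat.succ_pos 7).trans_le h8)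
  rw [Finset.mem_filter] at hd
  have h2 := hdiff _ _ _ hd.2.1 hd.2.2
  have hle : (Finset.univ.filter fun c => blockE t i c = 1 ∧ blockE t i' c = 0).card ≤
      (Finset.univ.filter fun c => matrixE (rowE i) c = 1 ∧ matrixE (rowE i') c = 0).card := by
    refine Finset.card_le_card_of_injOn (fun c => colE c) ?_ ?_
    · intro x hx
      simp only [Finset.coe_filter, Finset.mem_univ, true_and, Set.mem_ofPred_eq] at hx ⊢
      have := hdiff _ _ _ hx.1 hx.2
      rwa [blockE_of_eq (by omega), blockE_of_eq (by omega)] at hx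
    · intro x hx y hy hxy
      simp only [Finset.coe_filter, Finset.mem_univ, true_and, Set.mem_ofPred_eq] at hx hy
      have := hdiff _ _ _ hx.1 hx.2
      have := hdiff _ _ _ hy.1 hy.2
      have hmod : (x : ℕ) % 27 = (y : ℕ) % 27 := congrArg Fin.val hxy
      exact Fin.ext (by omega)
  have := card_matrixE_le (rowE i) (rowE i')
  omega

theorem le_forb {m n k l : ℕ} (hl : 0 < l) {F : Matrix (Fin k) (Fin l) (Fin 2)}
    {A : Matrix (Fin m) (Fin n) (Fin 2)}
    (hA : (⟨n, A⟩ : Σ n : ℕ, Matrix (Fin m) (Fin n) (Fin 2)) ∈ Avoid m F) : n ≤ forb m F :=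
  (isGreatest_forb m hl F).2 ⟨_, hA, rfl⟩

theorem forb_configF_eight_mul (t : ℕ) : forb (5 * t) (configF 8) = 27 * t + 1 := by
  have h1 := forb_configF_eight_le (5 * t)
  have h2 := le_forb (Nat.succ_pos 8) (blockE_mem_Avoid t)
  omega

end Matrices

theorem mainTheorem4 :
    (∀ m : ℕ, forb m (configF 8) ≤ ⌊(27 / 5 : ℚ) * (m : ℚ)⌋₊ + 1) ∧
    (∀ m : ℕ, m ≡ 0 [MOD 5] → forb m (configF 8) = ⌊(27 / 5 : ℚ) * (m : ℚ)⌋₊ + 1) ∧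
    (⟨28, matrixE⟩ : Σ n : ℕ, Matrix (Fin 5) (Fin n) (Fin 2)) ∈ Extremal 5 (configF 8) ∧
    (∀ t : ℕ, (⟨27 * t + 1, blockE t⟩ : Σ n : ℕ, Matrix (Fin (5 * t)) (Fin n) (Fin 2)) ∈
      Extremal (5 * t) (configF 8)) := by
  have hfloor : ∀ m : ℕ, ⌊(27 / 5 : ℚ) * (m : ℚ)⌋₊ = 27 * m / 5 := by
    intro m
    have : (27 / 5 : ℚ) * (m : ℚ) = ((27 * m : ℕ) : ℚ) / ((5 : ℕ) : ℚ) := by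
      push_cast
      ring
    rw [this, Nat.floor_div_eq_div]
  refine ⟨fun m => ?_, fun m hm => ?_, ⟨matrixE_mem_Avoid, (forb_configF_eight_mul 1).symm⟩,
    fun t => ⟨blockE_mem_Avoid t, (forb_configF_eight_mul t).symm⟩⟩
  · have := forb_configF_eight_le m
    rw [hfloor]
    omega
  · obtain ⟨t, rfl⟩ := (Nat.modEq_zero_iff_dvd).1 hm
    rw [hfloor, forb_configF_eight_mul]
    omega
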